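/- For positive integers $m,n,p$ and a tensor $x\in\mathbb{C}^m\otimes\mathbb{C}^n\otimes\mathbb{C}^p$, let $\operatorname{rank} x$ be the least $r\ge 0$ such that $x=\sum_{i=1}^r a_i\otimes b_i\otimes c_i$ for some $a_i\in\mathbb{C}^m$, $b_i\in\mathbb{C}^n$, $c_i\in\mathbb{C}^p$, and let $\mathrm{max.rank}_{\mathbb{C}}(m,n,p)$ be the maximum of $\operatorname{rank} x$ over all $x\in\mathbb{C}^m\otimes\mathbb{C}^n\otimes\mathbb{C}^p$. Then for every integer $n\ge 1$, $$\mathrm{max.rank}_{\mathbb{C}}(n,n,3)\le 2n-1\quad\text{and}\quad \mathrm{max.rank}_{\mathbb{C}}(n,n+1,3)\le 2n.$$ -/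

import Mathlib

open scoped TensorProduct

/-- The space `F^m ⊗ F^n ⊗ F^p` of `m × n × p` tensors over `F`. -/
abbrev Tensor3 (F : Type*) [Field F] (m n p : ℕ) : Type _ :=
  ((Fin m → F) ⊗[F] (Fin n → F)) ⊗[F] (Fin p → F)

/-- The tensor `x` is a sum of `r` tensors of the form `a ⊗ b ⊗ c`. -/
def IsSumOfPure {F : Type*} [Field F] {m n p : ℕ} (x : Tensor3 F m n p) (r : ℕ) : Prop :=
  ∃ (a : Fin r → Fin m → F) (b : Fin r → Fin n → F) (c : Fin r → Fin p → F),
    x = ∑ i, (a i ⊗ₜ[F] b i) ⊗ₜ[F] c i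

/-- The rank of a tensor: the least length of an expression as a sum of pure tensors. -/
noncomputable def tensorRank {F : Type*} [Field F] {m n p : ℕ} (x : Tensor3 F m n p) : ℕ :=
  sInf {r : ℕ | IsSumOfPure x r}

/-- The maximal rank of the `m × n × p` tensors over `F`. -/
noncomputable def maxRank (F : Type*) [Field F] (m n p : ℕ) : ℕ :=
  sSup (Set.range fun x : Tensor3 F m n p => tensorRank x)

theorem isSumOfPure_mul {F : Type*} [Field F] {m n p : ℕ} (x : Tensor3 F m n p) :
    IsSumOfPure x (m * n * p) := by
  let B := ((Pi.basisFun F (Fin m)).tensorProduct (Pi.basisFun F (Fin n))).tensorProduct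
    (Pi.basisFun F (Fin p))
  let e : Fin (m * n * p) ≃ (Fin m × Fin n) × Fin p :=
    (finProdFinEquiv.symm).trans (finProdFinEquiv.symm.prodCongr (Equiv.refl _))
  refine ⟨fun i => B.repr x (e i) • Pi.basisFun F (Fin m) (e i).1.1,
    fun i => Pi.basisFun F (Fin n) (e i).1.2, fun i => Pi.basisFun F (Fin p) (e i).2, ?_⟩
  conv_lhs => rw [← B.sum_repr x, ← e.sum_comp]
  refine Finset.sum_congr rfl fun i _ => ?_
  simp only [B, Module.Basis.tensorProduct_apply', TensorProduct.smul_tmul']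

/-- The minimum in the definition of the rank exists. -/
theorem isLeast_tensorRank {F : Type*} [Field F] {m n p : ℕ} (x : Tensor3 F m n p) :
    IsLeast {r : ℕ | IsSumOfPure x r} (tensorRank x) :=
  ⟨Nat.sInf_mem ⟨_, isSumOfPure_mul x⟩, fun _ h => Nat.sInf_le h⟩

/-- The maximum in the definition of the maximal rank exists. -/
theorem isGreatest_maxRank (F : Type*) [Field F] (m n p : ℕ) :
    IsGreatest (Set.range fun x : Tensor3 F m n p => tensorRank x) (maxRank F m n p) := by
  have hb : BddAbove (Set.range fun x : Tensor3 F m n p => tensorRank x) := by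
    refine ⟨m * n * p, ?_⟩
    rintro _ ⟨x, rfl⟩
    exact (isLeast_tensorRank x).2 (isSumOfPure_mul x)
  exact ⟨Nat.sSup_mem (Set.range_nonempty _) hb, fun _ h => le_csSup hb h⟩

/-! Read the tensor as a bilinear map `A z₀ + B z₁ + C z₂` with three forms on `X × Y`. Suppose that
`A` kills `u` on the left and `v` on the right, and that `(B, C)` does not vanish at `(u, v)`. Then
`dim X + dim Y - 1` products suffice (`bilinRankLE_of_diagonal`): peel `A` off one product at a
time. Each product enlarges by one a block on the kernels of `A` where `(B, C)` is diagonal with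
distinct roots, since a generic corner keeps a bordered matrix diagonalizable. Once `A` is gone, a
pencil with such a block of size `a` costs `dim X + dim Y - a`.

If `(B, C)` vanishes at `(u, v)`, either a first product creates a block of size two, or the slices
at `u` and `v` degenerate (`bilinRankLE_or_of_kernels`) and one of them can be split off, which
allows induction on the size.

Some combination of the forms must have a left kernel. In the square case an eigenvalue gives it; in
the `n × (n + 1)` case `Matrix.exists_singular_combination` does, by counting dimensions of
symmetric and skew matrices. -/

/-- The map `T` is a sum of `r` products `f x • g y • z` with `f`, `g` linear forms. -/
def BilinRankLE {X Y Z : Type*} [AddCommGroup X] [Module ℂ X] [AddCommGroup Y] [Module ℂ Y]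
    [AddCommGroup Z] [Module ℂ Z] (T : X → Y → Z) (r : ℕ) : Prop :=
  ∃ (f : Fin r → Module.Dual ℂ X) (g : Fin r → Module.Dual ℂ Y) (z : Fin r → Z),
    ∀ x y, T x y = ∑ i, f i x • g i y • z i

/-! ### Calculus of bilinear rank -/

namespace BilinRankLE

variable {X Y Z : Type*} [AddCommGroup X] [Module ℂ X] [AddCommGroup Y] [Module ℂ Y]
    [AddCommGroup Z] [Module ℂ Z]

theorem congr {T S : X → Y → Z} {r : ℕ} (hT : BilinRankLE T r) (h : ∀ x y, S x y = T x y) :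
    BilinRankLE S r := by
  obtain ⟨f, g, z, hfg⟩ := hT
  exact ⟨f, g, z, fun x y => (h x y).trans (hfg x y)⟩

theorem zero (r : ℕ) : BilinRankLE (fun (_ : X) (_ : Y) => (0 : Z)) r :=
  ⟨fun _ => 0, fun _ => 0, fun _ => 0, fun x y => by simp⟩

theorem add {T S : X → Y → Z} {r s : ℕ} (hT : BilinRankLE T r) (hS : BilinRankLE S s) :
    BilinRankLE (fun x y => T x y + S x y) (r + s) := by
  obtain ⟨f, g, z, h⟩ := hT
  obtain ⟨f', g', z', h'⟩ := hS
  refine ⟨Fin.append f f', Fin.append g g', Fin.append z z', fun x y => ?_⟩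
  simp [Fin.sum_univ_add, h, h']

theorem mono {T : X → Y → Z} {r s : ℕ} (hT : BilinRankLE T r) (h : r ≤ s) :
    BilinRankLE T s := by
  obtain ⟨k, rfl⟩ := Nat.exists_eq_add_of_le h
  exact (hT.add (zero k)).congr fun x y => by simp

theorem sum_pure {ι : Type*} [Fintype ι] (f : ι → Module.Dual ℂ X) (g : ι → Module.Dual ℂ Y)
    (z : ι → Z) : BilinRankLE (fun x y => ∑ i, f i x • g i y • z i) (Fintype.card ι) := by
  let e := (Fintype.equivFin ι).symm
  exact ⟨f ∘ e, g ∘ e, z ∘ e, fun x y =>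
    (e.sum_comp fun i => f i x • g i y • z i).symm⟩

theorem pure (f : Module.Dual ℂ X) (g : Module.Dual ℂ Y) (z : Z) :
    BilinRankLE (fun x y => f x • g y • z) 1 :=
  ⟨fun _ => f, fun _ => g, fun _ => z, fun x y => by simp⟩

theorem flip {T : X → Y → Z} {r : ℕ} (hT : BilinRankLE T r) :
    BilinRankLE (fun y x => T x y) r := by
  obtain ⟨f, g, z, h⟩ := hT
  exact ⟨g, f, z, fun y x => (h x y).trans <| Finset.sum_congr rfl fun i _ => smul_comm _ _ _⟩

theorem comp {X' Y' : Type*} [AddCommGroup X'] [Module ℂ X'] [AddCommGroup Y'] [Module ℂ Y']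
    {T : X → Y → Z} {r : ℕ} (hT : BilinRankLE T r) (p : X' →ₗ[ℂ] X) (q : Y' →ₗ[ℂ] Y) :
    BilinRankLE (fun x y => T (p x) (q y)) r := by
  obtain ⟨f, g, z, h⟩ := hT
  exact ⟨fun i => f i ∘ₗ p, fun i => g i ∘ₗ q, z, fun x y => h _ _⟩

theorem bilinForm_smul [FiniteDimensional ℂ X] [FiniteDimensional ℂ Y]
    (β : X →ₗ[ℂ] Y →ₗ[ℂ] ℂ) (z : Z) :
    BilinRankLE (fun x y => β x y • z) (Module.finrank ℂ (LinearMap.range β)) := by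
  let b := Module.finBasis ℂ (LinearMap.range β)
  refine ⟨fun i => b.coord i ∘ₗ β.rangeRestrict, fun i => (b i : Y →ₗ[ℂ] ℂ), fun _ => z,
    fun x y => ?_⟩
  have h := congrArg (fun w : LinearMap.range β => (w : Y →ₗ[ℂ] ℂ) y)
    (b.sum_repr (β.rangeRestrict x))
  change _ = β x y at h
  beta_reduce
  rw [← h, Submodule.coe_sum, LinearMap.sum_apply, Finset.sum_smul]
  refine Finset.sum_congr rfl fun i _ => ?_
  rw [Submodule.coe_smul, LinearMap.smul_apply, smul_eq_mul, mul_smul]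
  rfl

theorem bilinForm_smul_of_apply_eq_zero [FiniteDimensional ℂ X] [FiniteDimensional ℂ Y]
    (β : X →ₗ[ℂ] Y →ₗ[ℂ] ℂ) (z : Z) {ι : Type*} [Fintype ι] {u : ι → X}
    (hu : LinearIndependent ℂ u) (h : ∀ i, β (u i) = 0) :
    BilinRankLE (fun x y => β x y • z) (Module.finrank ℂ X - Fintype.card ι) := by
  refine (bilinForm_smul β z).mono ?_
  have h1 := LinearMap.finrank_range_add_finrank_ker β
  have h2 : Fintype.card ι ≤ Module.finrank ℂ (LinearMap.ker β) := by
    rw [← finrank_span_eq_card hu]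
    refine Submodule.finrank_mono (Submodule.span_le.2 ?_)
    rintro _ ⟨i, rfl⟩
    exact h i
  omega

end BilinRankLE

/-! ### Pencils with a diagonal block -/

theorem linearIndependent_of_biorthogonal {X ι : Type*} [AddCommGroup X] [Module ℂ X]
    [Fintype ι] [DecidableEq ι] {u : ι → X} {f : ι → Module.Dual ℂ X}
    (h : ∀ i j, f j (u i) = if i = j then 1 else 0) : LinearIndependent ℂ u := by
  rw [Fintype.linearIndependent_iff]
  intro c hc j
  have := congrArg (f j) hc
  simpa [h] using this

/-- A pencil that contains a diagonal block with distinct roots can be completed at the cost of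
one product for each further row and column. -/
theorem bilinRankLE_pencil {X Y Z : Type*} [AddCommGroup X] [Module ℂ X] [AddCommGroup Y]
    [Module ℂ Y] [AddCommGroup Z] [Module ℂ Z] [FiniteDimensional ℂ X] [FiniteDimensional ℂ Y]
    (B C : X →ₗ[ℂ] Y →ₗ[ℂ] ℂ) (z₁ z₂ : Z) {a : ℕ} {u : Fin a → X} {v : Fin a → Y}
    {l : Fin a → ℂ} (hB : ∀ i j, B (u i) (v j) = if i = j then 1 else 0)
    (hC : ∀ i j, C (u i) (v j) = if i = j then l i else 0) {r : ℕ}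
    (hr : Module.finrank ℂ X + Module.finrank ℂ Y ≤ r + a) :
    BilinRankLE (fun x y => B x y • z₁ + C x y • z₂) r := by
  -- Off the roots, `C - k • B` is invertible on the block, so its columns can be normalized.
  obtain ⟨k, hk⟩ := Infinite.exists_notMem_finset (Finset.univ.image l)
  have hk' : ∀ i, l i - k ≠ 0 := fun i h =>
    hk (Finset.mem_image.2 ⟨i, Finset.mem_univ _, sub_eq_zero.1 h⟩)
  -- With `f` from columns of `C - k • B` and `g` from rows of `B`, the same `a` products clear the
  -- rows `u i` of `B` and the columns `v j` of `C - k • B`. The remainders cost `dim X - a` and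
  -- `dim Y - a`.
  let f : Fin a → Module.Dual ℂ X := fun j => (l j - k)⁻¹ • (C - k • B).flip (v j)
  let g : Fin a → Module.Dual ℂ Y := fun i => B (u i)
  have hf : ∀ i j, f j (u i) = if i = j then 1 else 0 := by
    intro i j
    simp only [f, LinearMap.smul_apply, LinearMap.flip_apply, LinearMap.sub_apply, hB, hC,
      smul_eq_mul]
    split_ifs with h
    · subst h
      rw [mul_one, inv_mul_cancel₀ (hk' i)]
    · simp
  have hg : ∀ j i, g i (v j) = if j = i then 1 else 0 := by
    intro j i
    simp only [g, hB, eq_comm]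
  let β : X →ₗ[ℂ] Y →ₗ[ℂ] ℂ := B - ∑ i, (f i).smulRight (g i)
  let γ : X →ₗ[ℂ] Y →ₗ[ℂ] ℂ := (C - k • B) - ∑ i, (l i - k) • (f i).smulRight (g i)
  have hu := linearIndependent_of_biorthogonal hf
  have hv := linearIndependent_of_biorthogonal hg
  have hβ : ∀ i, β (u i) = 0 := by
    intro i
    simp [β, LinearMap.sum_apply, hf, g]
  have hγ : ∀ j, γ.flip (v j) = 0 := by
    intro j
    ext x
    simp only [γ, LinearMap.flip_apply, LinearMap.sub_apply, LinearMap.sum_apply,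
      LinearMap.smul_apply, LinearMap.smulRight_apply, hg, LinearMap.zero_apply, smul_eq_mul]
    simp [f, mul_inv_cancel_left₀ (hk' j)]
  have h1 := BilinRankLE.bilinForm_smul_of_apply_eq_zero β (z₁ + k • z₂) hu hβ
  have h2 := (BilinRankLE.bilinForm_smul_of_apply_eq_zero γ.flip z₂ hv hγ).flip
  have h3 := BilinRankLE.sum_pure f g fun i => z₁ + l i • z₂
  have hcu := hu.fintype_card_le_finrank
  have hcv := hv.fintype_card_le_finrank
  simp only [Fintype.card_fin] at h1 h2 h3 hcu hcv
  refine (((h1.add h2).add h3).mono (by omega)).congr fun x y => ?_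
  have e1 : ∑ i, f i x • g i y • (z₁ + l i • z₂) =
      (∑ i, f i x * g i y) • z₁ + (∑ i, l i * (f i x * g i y)) • z₂ := by
    rw [Finset.sum_smul, Finset.sum_smul, ← Finset.sum_add_distrib]
    exact Finset.sum_congr rfl fun i _ => by module
  have e2 : β x y = B x y - ∑ i, f i x * g i y := by simp [β, LinearMap.sum_apply]
  have e3 : γ x y = C x y - k * B x y -
      (∑ i, l i * (f i x * g i y) - k * ∑ i, f i x * g i y) := by
    simp [γ, LinearMap.sum_apply, sub_mul, Finset.mul_sum]
  rw [e1, LinearMap.flip_apply, e2, e3]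
  module
-- Bordering a diagonal matrix
-- A multiple root of `F - μ P` is a zero of the Wronskian of `P` and `F`, and that zero determines
-- `μ`; so only finitely many `μ` fail.
open Polynomial in
theorem exists_separable_sub_C_mul {P F : ℂ[X]} (hP : P.Monic) (hF : F.Monic)
    (hPs : P.Separable) (hdeg : F.natDegree = P.natDegree + 1) :
    ∃ μ : ℂ, (F - C μ * P).Separable := by
  have hG : P * derivative F - derivative P * F ≠ 0 := by
    intro h
    have h1 : P ∣ derivative P * F := ⟨derivative F, (sub_eq_zero.1 h).symm⟩
    obtain ⟨H, rfl⟩ := IsCoprime.dvd_of_dvd_mul_left hPs h1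
    have hH : derivative H = 0 := by
      have : P * P * derivative H = 0 := by
        rw [← h, derivative_mul]; ring
      simpa [hP.ne_zero] using this
    have := derivative_eq_zero.1 hH
    have hH0 : H ≠ 0 := fun h0 => hF.ne_zero (by simp [h0])
    rw [natDegree_mul hP.ne_zero hH0] at hdeg
    omega
  -- At a zero of `P` the derivatives determine `μ`, because `P` has simple roots.
  let b : ℂ → ℂ := fun t =>
    if P.eval t = 0 then (derivative F).eval t / (derivative P).eval t else F.eval t / P.eval t
  obtain ⟨μ, hμ⟩ := Infinite.exists_notMem_finset
    ((P * derivative F - derivative P * F).roots.toFinset.image b)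
  refine ⟨μ, ?_⟩
  rw [Polynomial.separable_def]
  by_contra hcop
  rw [Polynomial.isCoprime_iff_aeval_ne_zero_of_isAlgClosed ℂ ℂ] at hcop
  push Not at hcop
  obtain ⟨t, ht1, ht2⟩ := hcop
  simp only [coe_aeval_eq_eval, eval_sub, eval_mul, eval_C, derivative_sub,
    derivative_C_mul] at ht1 ht2
  refine hμ (Finset.mem_image.2 ⟨t, ?_, ?_⟩)
  · rw [Multiset.mem_toFinset, mem_roots hG, IsRoot.def, eval_sub, eval_mul, eval_mul]
    linear_combination P.eval t * ht2 - (derivative P).eval t * ht1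
  · simp only [b]
    split_ifs with h0
    · have hP' : (derivative P).eval t ≠ 0 := by
        intro h'
        obtain ⟨x, y, hxy⟩ := hPs
        have := congrArg (eval t) hxy
        simp [h0, h'] at this
      rw [div_eq_iff hP']
      linear_combination ht2
    · rw [div_eq_iff h0]
      linear_combination ht1

/-- The square matrix `Λ` bordered by a row `x`, a column `y` and the corner `μ`. -/
def borderedMatrix {a : ℕ} (Λ : Matrix (Fin a) (Fin a) ℂ) (x y : Fin a → ℂ) (μ : ℂ) :
    Matrix (Fin (a + 1)) (Fin (a + 1)) ℂ :=
  Matrix.of (Fin.cons (Fin.cons μ x) fun i => Fin.cons (y i) (Λ i))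

-- In the expansion along the first row, `μ` occurs only in the corner, whose cofactor is the
-- characteristic polynomial of `Λ`.
open Polynomial in
theorem charpoly_borderedMatrix {a : ℕ} (Λ : Matrix (Fin a) (Fin a) ℂ) (x y : Fin a → ℂ)
    (μ : ℂ) : (borderedMatrix Λ x y μ).charpoly =
      (borderedMatrix Λ x y 0).charpoly - C μ * Λ.charpoly := by
  have h0 : (borderedMatrix Λ x y μ).charmatrix.submatrix Fin.succ Fin.succ = Λ.charmatrix := by
    ext i j : 2
    simp [borderedMatrix, Matrix.charmatrix_apply, Matrix.diagonal_apply]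
  have h0' : (borderedMatrix Λ x y 0).charmatrix.submatrix Fin.succ Fin.succ =
      Λ.charmatrix := by
    ext i j : 2
    simp [borderedMatrix, Matrix.charmatrix_apply, Matrix.diagonal_apply]
  have h1 : ∀ j : Fin a, (borderedMatrix Λ x y μ).charmatrix.submatrix Fin.succ
      (j.succ).succAbove = (borderedMatrix Λ x y 0).charmatrix.submatrix Fin.succ
        (j.succ).succAbove := by
    intro j
    ext i k : 2
    simp [borderedMatrix, Matrix.charmatrix_apply]
  simp only [Matrix.charpoly]
  rw [Matrix.det_succ_row_zero, Matrix.det_succ_row_zero, Fin.sum_univ_succ, Fin.sum_univ_succ]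
  simp only [h1, Fin.succAbove_zero, h0, h0']
  have e : ∀ (ν : ℂ) (j : Fin a), (borderedMatrix Λ x y ν).charmatrix 0 j.succ = - C (x j) := by
    intro ν j
    rw [Matrix.charmatrix_apply_ne _ _ _ (Fin.succ_ne_zero j).symm]
    simp [borderedMatrix]
  have e0 : ∀ (ν : ℂ), (borderedMatrix Λ x y ν).charmatrix 0 0 = X - C ν := by
    intro ν
    rw [Matrix.charmatrix_apply_eq]
    simp [borderedMatrix]
  simp only [e, e0]
  simp
  ring

theorem exists_diagonalization_of_separable_charpoly {n : ℕ} (N : Matrix (Fin n) (Fin n) ℂ)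
    (h : N.charpoly.Separable) :
    ∃ (P Q : Matrix (Fin n) (Fin n) ℂ) (l : Fin n → ℂ), Function.Injective l ∧ Q * P = 1 ∧
      Q * N * P = Matrix.diagonal l := by
  have hcard : N.charpoly.roots.toFinset.card = n := by
    rw [Multiset.toFinset_card_of_nodup (Polynomial.nodup_roots h),
      IsAlgClosed.card_roots_eq_natDegree, Matrix.charpoly_natDegree_eq_dim, Fintype.card_fin]
  let e := (Finset.equivFinOfCardEq hcard).symm
  let l : Fin n → ℂ := fun i => (e i : ℂ)
  have hl : Function.Injective l := Subtype.val_injective.comp e.injective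
  have hroot : ∀ i, N.charpoly.IsRoot (l i) := fun i =>
    Polynomial.isRoot_of_mem_roots (Multiset.mem_toFinset.1 (e i).2)
  have hev : ∀ i, Module.End.HasEigenvalue (Matrix.toLin' N) (l i) := by
    intro i
    rw [Module.End.hasEigenvalue_iff_isRoot_charpoly, Matrix.charpoly_toLin']
    exact hroot i
  choose w hw using fun i => (hev i).exists_hasEigenvector
  have hli := Module.End.eigenvectors_linearIndependent' (Matrix.toLin' N) l hl w hw
  let P : Matrix (Fin n) (Fin n) ℂ := (Matrix.of w).transpose
  have hPu : IsUnit P := by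
    rw [← Matrix.linearIndependent_cols_iff_isUnit]
    exact hli
  have hQ : P⁻¹ * P = 1 := Matrix.nonsing_inv_mul P ((Matrix.isUnit_iff_isUnit_det P).1 hPu)
  refine ⟨P, P⁻¹, l, hl, hQ, ?_⟩
  have hNP : N * P = P * Matrix.diagonal l := by
    ext i j
    have := congrFun (hw j).apply_eq_smul i
    rw [Matrix.mul_diagonal]
    simpa [Matrix.toLin'_apply, Matrix.mulVec, dotProduct, Matrix.mul_apply, P, mul_comm]
      using this
  rw [Matrix.mul_assoc, hNP, ← Matrix.mul_assoc, hQ, Matrix.one_mul]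

theorem exists_diagonalization_borderedMatrix {a : ℕ} {l : Fin a → ℂ}
    (hl : Function.Injective l) (x y : Fin a → ℂ) :
    ∃ (μ : ℂ) (P Q : Matrix (Fin (a + 1)) (Fin (a + 1)) ℂ) (l' : Fin (a + 1) → ℂ),
      Function.Injective l' ∧ Q * P = 1 ∧
      Q * borderedMatrix (Matrix.diagonal l) x y μ * P = Matrix.diagonal l' := by
  have hs : (Matrix.diagonal l).charpoly.Separable := by
    rw [Matrix.charpoly_diagonal]
    exact Polynomial.separable_prod_X_sub_C_iff.2 hl
  obtain ⟨μ, hμ⟩ := exists_separable_sub_C_mul (Matrix.charpoly_monic (Matrix.diagonal l))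
    (Matrix.charpoly_monic (borderedMatrix (Matrix.diagonal l) x y 0)) hs
    (by simp [Matrix.charpoly_natDegree_eq_dim])
  rw [← charpoly_borderedMatrix] at hμ
  exact ⟨μ, exists_diagonalization_of_separable_charpoly _ hμ⟩

/-! ### Peeling off the first form -/

theorem bilin_sum_smul_sum_smul {X Y ι : Type*} [AddCommGroup X] [Module ℂ X] [AddCommGroup Y]
    [Module ℂ Y] [Fintype ι] (β : X →ₗ[ℂ] Y →ₗ[ℂ] ℂ) (U : ι → X) (V : ι → Y)
    {M : Matrix ι ι ℂ} (hM : ∀ i j, β (U i) (V j) = M i j) (Q P : Matrix ι ι ℂ) (i j : ι) :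
    β (∑ k, Q i k • U k) (∑ k, P k j • V k) = (Q * M * P) i j := by
  simp only [map_sum, map_smul, LinearMap.sum_apply, LinearMap.smul_apply, hM, smul_eq_mul,
    Matrix.mul_apply, Finset.mul_sum, Finset.sum_mul]
  refine Finset.sum_congr rfl fun k _ => Finset.sum_congr rfl fun k' _ => ?_
  ring

/-- Wedderburn's rank reduction: the left kernel survives and gains `e`. -/
theorem finrank_range_sub_smulRight_lt {X Y : Type*} [AddCommGroup X] [Module ℂ X]
    [AddCommGroup Y] [Module ℂ Y] [FiniteDimensional ℂ X]
    (A : X →ₗ[ℂ] Y →ₗ[ℂ] ℂ) {e : X} {h : Y} (heh : A e h = 1) :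
    Module.finrank ℂ (LinearMap.range (A - (A.flip h).smulRight (A e))) <
      Module.finrank ℂ (LinearMap.range A) := by
  have h1 := LinearMap.finrank_range_add_finrank_ker A
  have h2 := LinearMap.finrank_range_add_finrank_ker (A - (A.flip h).smulRight (A e))
  have hlt : LinearMap.ker A < LinearMap.ker (A - (A.flip h).smulRight (A e)) := by
    refine lt_of_le_of_ne (fun x hx => ?_) fun heq => ?_
    · rw [LinearMap.mem_ker] at hx ⊢
      simp [hx]
    · have he : e ∈ LinearMap.ker A := by
        rw [heq, LinearMap.mem_ker]
        simp [heh]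
      rw [LinearMap.mem_ker] at he
      simp [he] at heh
  have h3 := Submodule.finrank_lt_finrank_of_lt hlt
  omega

/-- A triple of forms that contains a diagonal pencil with distinct roots on the kernels of the
first one. -/
theorem bilinRankLE_of_diagonal {X Y Z : Type*} [AddCommGroup X] [Module ℂ X] [AddCommGroup Y]
    [Module ℂ Y] [AddCommGroup Z] [Module ℂ Z] [FiniteDimensional ℂ X] [FiniteDimensional ℂ Y]
    (A B C : X →ₗ[ℂ] Y →ₗ[ℂ] ℂ) (z₀ z₁ z₂ : Z) {a : ℕ} {u : Fin a → X} {v : Fin a → Y}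
    {l : Fin a → ℂ} (hl : Function.Injective l) (hAu : ∀ i, A (u i) = 0)
    (hAv : ∀ x j, A x (v j) = 0) (hB : ∀ i j, B (u i) (v j) = if i = j then 1 else 0)
    (hC : ∀ i j, C (u i) (v j) = if i = j then l i else 0) {r : ℕ}
    (hr : Module.finrank ℂ X + Module.finrank ℂ Y ≤ r + a) :
    BilinRankLE (fun x y => A x y • z₀ + B x y • z₁ + C x y • z₂) r := by
  -- Each step trades one unit of the rank of `A` for one unit of `a`, at the price of one product.
  induction hk : Module.finrank ℂ (LinearMap.range A) using Nat.strong_induction_on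
    generalizing A B C a r with
  | _ k ih =>
  by_cases hA : A = 0
  · exact (bilinRankLE_pencil B C z₁ z₂ hB hC hr).congr fun x y => by simp [hA]
  obtain ⟨e, h, heh, hBe, hBh⟩ : ∃ e h, A e h = 1 ∧ (∀ j, B e (v j) = 0) ∧
      ∀ i, B (u i) h = 0 := by
    obtain ⟨e, he⟩ : ∃ e, A e ≠ 0 := by
      by_contra! h
      exact hA (LinearMap.ext h)
    obtain ⟨h, hh⟩ : ∃ h, A e h ≠ 0 := by
      by_contra! h
      exact he (LinearMap.ext h)
    -- Correcting by the `u i` and `v j` makes both vectors `B`-orthogonal to the block without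
    -- changing the value of `A`.
    refine ⟨(A e h)⁻¹ • (e - ∑ i, B e (v i) • u i), h - ∑ j, B (u j) h • v j, ?_, ?_, ?_⟩
    · simp [map_sum, hAu, hAv, hh]
    · intro j
      simp [LinearMap.sum_apply, hB]
    · intro i
      simp [hB]
  let f : Module.Dual ℂ X := A.flip h
  let g : Module.Dual ℂ Y := A e
  have hfe : f e = 1 := heh
  have hgh : g h = 1 := heh
  have hfu : ∀ i, f (u i) = 0 := fun i => by simp [f, hAu]
  have hgv : ∀ j, g (v j) = 0 := fun j => hAv e j
  obtain ⟨μ, P, Q, l', hl', hQP, hdiag⟩ :=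
    exists_diagonalization_borderedMatrix hl (fun j => C e (v j)) (fun i => C (u i) h)
  let R : X →ₗ[ℂ] Y →ₗ[ℂ] ℂ := f.smulRight g
  have hR : ∀ x y, R x y = f x * g y := fun x y => rfl
  -- Multiples of `R` in all three forms are paid for by a single product, so the corners of `B` and
  -- `C` can be set to `1` and `μ`.
  let A' := A - R
  let B' := B - (B e h - 1) • R
  let C' := C - (C e h - μ) • R
  let U : Fin (a + 1) → X := Fin.cons e u
  let V : Fin (a + 1) → Y := Fin.cons h v
  have hA'U : ∀ i, A' (U i) = 0 := by
    intro i
    ext y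
    refine Fin.cases ?_ (fun i => ?_) i
    · simp [A', U, hR, hfe, g]
    · simp [A', U, hR, hfu, hAu]
  have hA'V : ∀ x j, A' x (V j) = 0 := by
    intro x j
    refine Fin.cases ?_ (fun j => ?_) j
    · simp [A', V, hR, hgh, f]
    · simp [A', V, hR, hgv, hAv]
  have hB'UV : ∀ i j, B' (U i) (V j) = (1 : Matrix (Fin (a + 1)) (Fin (a + 1)) ℂ) i j := by
    intro i j
    refine Fin.cases ?_ (fun i => ?_) i <;> refine Fin.cases ?_ (fun j => ?_) j <;>
      simp [B', U, V, hR, hfe, hgh, hfu, hgv, hBe, hBh, hB, Matrix.one_apply,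
        Fin.succ_ne_zero, (Fin.succ_ne_zero _).symm]
  have hC'UV : ∀ i j, C' (U i) (V j) = borderedMatrix (Matrix.diagonal l)
      (fun j => C e (v j)) (fun i => C (u i) h) μ i j := by
    intro i j
    refine Fin.cases ?_ (fun i => ?_) i <;> refine Fin.cases ?_ (fun j => ?_) j <;>
      simp [C', U, V, hR, hfe, hgh, hfu, hgv, hC, borderedMatrix, Matrix.diagonal_apply]
  have hu := linearIndependent_of_biorthogonal (f := fun j => B.flip (v j)) hB
  have hcu := hu.fintype_card_le_finrank
  rw [Fintype.card_fin] at hcu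
  have hY : 0 < Module.finrank ℂ Y := by
    have : Nontrivial Y := ⟨h, 0, fun h0 => by simp [h0] at heh⟩
    exact Module.finrank_pos
  -- Here `r ≥ 1`, because `a ≤ dim X` and `dim Y > 0`.
  obtain ⟨s, rfl⟩ : ∃ s, r = s + 1 := ⟨r - 1, by omega⟩
  have key := ih _ (hk ▸ finrank_range_sub_smulRight_lt A heh) A' B' C'
    (u := fun i => ∑ k, Q i k • U k) (v := fun j => ∑ k, P k j • V k) (l := l') hl'
    (fun i => by simp [hA'U]) (fun x j => by simp [hA'V])
    (fun i j => by
      rw [bilin_sum_smul_sum_smul B' U V hB'UV, Matrix.mul_one, hQP, Matrix.one_apply])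
    (fun i j => by
      rw [bilin_sum_smul_sum_smul C' U V hC'UV, hdiag, Matrix.diagonal_apply])
    (r := s) (by omega) rfl
  refine (key.add (BilinRankLE.pure f g
    (z₀ + (B e h - 1) • z₁ + (C e h - μ) • z₂))).congr fun x y => ?_
  simp only [A', B', C', LinearMap.sub_apply, LinearMap.smul_apply, hR, smul_eq_mul]
  module

/-! ### A left and a right kernel vector -/

theorem exists_apply_ne_zero_and {V : Type*} [AddCommGroup V] [Module ℂ V]
    {f g : Module.Dual ℂ V} (hf : f ≠ 0) (hg : g ≠ 0) : ∃ x, f x ≠ 0 ∧ g x ≠ 0 := by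
  by_contra! H
  obtain ⟨x, hx⟩ := DFunLike.ne_iff.1 hf
  obtain ⟨y, hy⟩ := DFunLike.ne_iff.1 hg
  rw [LinearMap.zero_apply] at hx hy
  have h1 := H x hx
  have h2 : f y = 0 := by_contra fun h => hy (H y h)
  exact hy (by simpa [h1] using H (x + y) (by simpa [h2] using hx))

theorem exists_bilin_apply_ne_zero_and {X Y : Type*} [AddCommGroup X] [Module ℂ X]
    [AddCommGroup Y] [Module ℂ Y] {β γ : X →ₗ[ℂ] Y →ₗ[ℂ] ℂ} (hβ : β ≠ 0) (hγ : γ ≠ 0) :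
    ∃ x y, β x y ≠ 0 ∧ γ x y ≠ 0 := by
  have aux : ∀ {δ : X →ₗ[ℂ] Y →ₗ[ℂ] ℂ}, δ ≠ 0 → ∃ y, δ.flip y ≠ 0 := by
    intro δ hδ
    by_contra! H
    exact hδ (LinearMap.ext fun x => LinearMap.ext fun y => LinearMap.congr_fun (H y) x)
  obtain ⟨y₁, h₁⟩ := aux hβ
  obtain ⟨y₂, h₂⟩ := aux hγ
  obtain ⟨x, hx₁, hx₂⟩ := exists_apply_ne_zero_and h₁ h₂
  obtain ⟨y, hy⟩ := exists_apply_ne_zero_and (f := β x) (g := γ x)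
    (fun h => hx₁ (by simp [h])) (fun h => hx₂ (by simp [h]))
  exact ⟨x, y, hy⟩

theorem bilinRankLE_of_kernels {X Y Z : Type*} [AddCommGroup X] [Module ℂ X] [AddCommGroup Y]
    [Module ℂ Y] [AddCommGroup Z] [Module ℂ Z] [FiniteDimensional ℂ X] [FiniteDimensional ℂ Y]
    (A B C : X →ₗ[ℂ] Y →ₗ[ℂ] ℂ) (z₀ z₁ z₂ : Z) {u : X} {v : Y} (hu : A u = 0)
    (hv : ∀ x, A x v = 0) (huv : B u v ≠ 0 ∨ C u v ≠ 0) {r : ℕ}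
    (hr : Module.finrank ℂ X + Module.finrank ℂ Y ≤ r + 1) :
    BilinRankLE (fun x y => A x y • z₀ + B x y • z₁ + C x y • z₂) r := by
  rcases huv with hBuv | hCuv
  · exact bilinRankLE_of_diagonal A B C z₀ z₁ z₂ (a := 1) (u := fun _ => (B u v)⁻¹ • u)
      (v := fun _ => v) (l := fun _ => (B u v)⁻¹ * C u v) (Function.injective_of_subsingleton _)
      (by simp [hu]) (by simp [hv]) (fun i j => by simp [Subsingleton.elim i j, hBuv])
      (fun i j => by simp [Subsingleton.elim i j]) hr
  · refine (bilinRankLE_of_diagonal A C B z₀ z₂ z₁ (a := 1) (u := fun _ => (C u v)⁻¹ • u)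
      (v := fun _ => v) (l := fun _ => (C u v)⁻¹ * B u v) (Function.injective_of_subsingleton _)
      (by simp [hu]) (by simp [hv]) (fun i j => by simp [Subsingleton.elim i j, hCuv])
      (fun i j => by simp [Subsingleton.elim i j]) hr).congr fun x y => ?_
    abel

/-- A vector in the left kernel and one in the right kernel of the first form: either the bound
for the rank holds, or the slice at `v` is a multiple of one vector, or the slice at `u`
vanishes. -/
theorem bilinRankLE_or_of_kernels {X Y Z : Type*} [AddCommGroup X] [Module ℂ X] [AddCommGroup Y]
    [Module ℂ Y] [AddCommGroup Z] [Module ℂ Z] [FiniteDimensional ℂ X] [FiniteDimensional ℂ Y]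
    (A B C : X →ₗ[ℂ] Y →ₗ[ℂ] ℂ) (z₀ z₁ z₂ : Z) {u : X} {v : Y} (hu : A u = 0)
    (hv : ∀ x, A x v = 0) {r : ℕ} (hr : Module.finrank ℂ X + Module.finrank ℂ Y ≤ r + 1) :
    BilinRankLE (fun x y => A x y • z₀ + B x y • z₁ + C x y • z₂) r ∨
      (∃ (f : Module.Dual ℂ X) (z : Z), ∀ x, B x v • z₁ + C x v • z₂ = f x • z) ∨
      (B u = 0 ∧ C u = 0) := by
  by_cases hBCuv : B u v ≠ 0 ∨ C u v ≠ 0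
  · exact Or.inl (bilinRankLE_of_kernels A B C z₀ z₁ z₂ hu hv hBCuv hr)
  push Not at hBCuv
  obtain ⟨hBuv, hCuv⟩ := hBCuv
  -- `M x y` is the determinant of the values of `(B, C)` at `(x, v)` and `(u, y)`. If it vanishes
  -- identically and the slice at `u` does not, all values of the slice at `v` lie on one line.
  let M : X →ₗ[ℂ] Y →ₗ[ℂ] ℂ := (B.flip v).smulRight (C u) - (C.flip v).smulRight (B u)
  have hM : ∀ x y, M x y = B x v * C u y - C x v * B u y := fun x y => rfl
  by_cases hM0 : M = 0
  · right
    by_cases hBC : B u = 0 ∧ C u = 0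
    · exact Or.inr hBC
    left
    have hM' : ∀ x y, B x v * C u y = C x v * B u y := fun x y =>
      sub_eq_zero.1 ((hM x y).symm.trans (by simp [hM0]))
    by_cases hBu : B u = 0
    · have hCu : C u ≠ 0 := fun h => hBC ⟨hBu, h⟩
      obtain ⟨y, hy⟩ := DFunLike.ne_iff.1 hCu
      refine ⟨C.flip v, z₂, fun x => ?_⟩
      have hx : B x v = 0 := by
        have := hM' x y
        rw [hBu, LinearMap.zero_apply, mul_zero] at this
        exact (mul_eq_zero.1 this).resolve_right hy
      simp [hx]
    · obtain ⟨y, hy⟩ := DFunLike.ne_iff.1 hBu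
      rw [LinearMap.zero_apply] at hy
      refine ⟨B.flip v, z₁ + ((B u y)⁻¹ * C u y) • z₂, fun x => ?_⟩
      have hx : C x v = B x v * ((B u y)⁻¹ * C u y) := by
        field_simp
        exact (hM' x y).symm
      rw [hx, LinearMap.flip_apply]
      module
  left
  by_cases hA0 : A = 0
  · obtain ⟨x, y, hxy, -⟩ := exists_bilin_apply_ne_zero_and hM0 hM0
    refine bilinRankLE_of_kernels A B C z₀ z₁ z₂ (u := x) (v := v) (by simp [hA0]) hv ?_ hr
    by_contra! H
    exact hxy (by simp [hM, H.1, H.2])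
  obtain ⟨e, h, heh, hΔ⟩ : ∃ e h, A e h = 1 ∧ M e h ≠ 0 := by
    obtain ⟨e, h, he, hMeh⟩ := exists_bilin_apply_ne_zero_and hA0 hM0
    exact ⟨(A e h)⁻¹ • e, h, by simp [he], by simp [he, hMeh]⟩
  rw [hM] at hΔ
  have hX : 0 < Module.finrank ℂ X := by
    have : Nontrivial X := ⟨e, 0, fun h0 => by simp [h0] at heh⟩
    exact Module.finrank_pos
  have hY : 0 < Module.finrank ℂ Y := by
    have : Nontrivial Y := ⟨h, 0, fun h0 => by simp [h0] at heh⟩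
    exact Module.finrank_pos
  obtain ⟨s, rfl⟩ : ∃ s, r = s + 1 := ⟨r - 1, by omega⟩
  let f : Module.Dual ℂ X := A.flip h
  let g : Module.Dual ℂ Y := A e
  have hfe : f e = 1 := heh
  have hgh : g h = 1 := heh
  have hfu : f u = 0 := by simp [f, hu]
  have hgv : g v = 0 := hv e
  let R : X →ₗ[ℂ] Y →ₗ[ℂ] ℂ := f.smulRight g
  have hR : ∀ x y, R x y = f x * g y := fun x y => rfl
  let A' := A - R
  let B' := B - B e h • R
  let C' := C - C e h • R
  set p₁ := B e v with hp₁
  set p₂ := C e v with hp₂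
  set q₁ := B u h with hq₁
  set q₂ := C u h with hq₂
  set Δ := p₁ * q₂ - p₂ * q₁ with hΔ'
  -- On `(e, u) × (h, v)` the pencil `(B', C')` is antidiagonal with entries `(p₁, p₂)` and `(q₁,
  -- q₂)`, independent since `Δ ≠ 0`. `α` and `β` are the coordinates in that basis.
  let β := Δ⁻¹ • (p₁ • C' - p₂ • B')
  let α := Δ⁻¹ • (q₂ • B' - q₁ • C')
  have hA'e : A' e = 0 := by
    ext y
    simp [A', hR, hfe, g]
  have hA'u : A' u = 0 := by
    ext y
    simp [A', hR, hfu, hu]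
  have hA'h : ∀ x, A' x h = 0 := fun x => by simp [A', hR, hgh, f]
  have hA'v : ∀ x, A' x v = 0 := fun x => by simp [A', hR, hgv, hv]
  have hα : ∀ x y, α x y = Δ⁻¹ * (q₂ * B' x y - q₁ * C' x y) := fun x y => rfl
  have hβ : ∀ x y, β x y = Δ⁻¹ * (p₁ * C' x y - p₂ * B' x y) := fun x y => rfl
  have hB' : ∀ x y, B' x y = B x y - B e h * (f x * g y) := fun x y => rfl
  have hC' : ∀ x y, C' x y = C x y - C e h * (f x * g y) := fun x y => rfl
  have hev : α e v = 1 ∧ β e v = 0 := by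
    simp only [hα, hβ, hB', hC', hgv, ← hp₁, ← hp₂]
    refine ⟨?_, by ring⟩
    rw [inv_mul_eq_one₀ hΔ]
    ring
  have huh : α u h = 0 ∧ β u h = 1 := by
    simp only [hα, hβ, hB', hC', hfu, ← hq₁, ← hq₂]
    refine ⟨by ring, ?_⟩
    rw [inv_mul_eq_one₀ hΔ]
    ring
  have heh' : α e h = 0 ∧ β e h = 0 := by
    simp [hα, hβ, hB', hC', hfe, hgh]
  have huv : α u v = 0 ∧ β u v = 0 := by
    simp [hα, hβ, hB', hC', hfu, hBuv, hCuv]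
  -- Listing `v` before `h` makes the block diagonal: `α + β` is the identity and `β` has roots `0,
  -- 1`. Size two repays the product spent on `R`.
  have key := bilinRankLE_of_diagonal A' (α + β) β z₀ (p₁ • z₁ + p₂ • z₂)
    (q₁ • z₁ + q₂ • z₂ - (p₁ • z₁ + p₂ • z₂)) (a := 2) (u := ![e, u]) (v := ![v, h])
    (l := ![0, 1]) (by intro i j; fin_cases i <;> fin_cases j <;> simp)
    (by intro i; fin_cases i <;> simp [hA'e, hA'u])
    (by intro x i; fin_cases i <;> simp [hA'h, hA'v])
    (by intro i j; fin_cases i <;> fin_cases j <;> simp [hev, huh, heh', huv])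
    (by intro i j; fin_cases i <;> fin_cases j <;> simp [hev, huh, heh', huv])
    (r := s) (by omega)
  refine (key.add (BilinRankLE.pure f g (z₀ + B e h • z₁ + C e h • z₂))).congr fun x y => ?_
  have h1 : α x y * p₁ + β x y * q₁ = B' x y := by
    rw [hα, hβ]
    field_simp
    ring
  have h2 : α x y * p₂ + β x y * q₂ = C' x y := by
    rw [hα, hβ]
    field_simp
    ring
  have h3 : A x y = A' x y + f x * g y := by simp [A', hR]
  have h4 : B x y = B' x y + B e h * (f x * g y) := by rw [hB']; ring
  have h5 : C x y = C' x y + C e h * (f x * g y) := by rw [hC']; ring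
  rw [h3, h4, h5, ← h1, ← h2, LinearMap.add_apply, LinearMap.add_apply]
  module

/-! ### Singular combinations of linear maps -/

/-- If `B` is injective it is invertible, and an eigenvector of `B⁻¹A` serves. -/
theorem exists_singular_combination {V W : Type*} [AddCommGroup V] [Module ℂ V]
    [AddCommGroup W] [Module ℂ W] [FiniteDimensional ℂ V] [FiniteDimensional ℂ W]
    [Nontrivial V] (A B : V →ₗ[ℂ] W) (h : Module.finrank ℂ W ≤ Module.finrank ℂ V) :
    ∃ (α β : ℂ) (u : V), (α ≠ 0 ∨ β ≠ 0) ∧ u ≠ 0 ∧ α • A u + β • B u = 0 := by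
  by_cases hB : Function.Injective B
  · let E := LinearEquiv.ofInjectiveOfFinrankEq B hB
      (le_antisymm (LinearMap.finrank_le_finrank_of_injective hB) h)
    obtain ⟨c, hc⟩ := Module.End.exists_eigenvalue (E.symm.toLinearMap ∘ₗ A)
    obtain ⟨u, hu⟩ := hc.exists_hasEigenvector
    refine ⟨1, -c, u, Or.inl one_ne_zero, hu.2, ?_⟩
    have h1 : E.symm (A u) = c • u := hu.apply_eq_smul
    have h2 : A u = c • B u := by
      rw [LinearEquiv.symm_apply_eq, map_smul] at h1
      exact h1
    rw [h2]
    module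
  · rw [← LinearMap.ker_eq_bot, Submodule.eq_bot_iff] at hB
    push Not at hB
    obtain ⟨u, hu, hu0⟩ := hB
    exact ⟨0, 1, u, Or.inr one_ne_zero, hu0, by simpa using hu⟩

/-- The symmetric matrix with prescribed entries. -/
def symMatrix {n : ℕ} : (Sym2 (Fin n) → ℂ) →ₗ[ℂ] Matrix (Fin n) (Fin n) ℂ where
  toFun f := Matrix.of fun i j => f s(i, j)
  map_add' _ _ := rfl
  map_smul' _ _ := rfl

theorem symMatrix_transpose {n : ℕ} (f : Sym2 (Fin n) → ℂ) :
    (symMatrix f).transpose = symMatrix f := by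
  ext i j
  exact congrArg f Sym2.eq_swap

/-- The entries above the diagonal of the skew matrix `A S Bᵀ - B S Aᵀ`, for `S` symmetric. -/
def skewEntries {n : ℕ} (A B : Matrix (Fin (n + 1)) (Fin n) ℂ) :
    (Sym2 (Fin n) → ℂ) →ₗ[ℂ] ({p : Fin (n + 1) × Fin (n + 1) // p.1 < p.2} → ℂ) where
  toFun f p := (A * symMatrix f * B.transpose - B * symMatrix f * A.transpose) p.1.1 p.1.2
  map_add' f g := by
    ext p
    simp only [map_add, Matrix.mul_add, Matrix.add_mul, Matrix.sub_apply, Matrix.add_apply,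
      Pi.add_apply]
    ring
  map_smul' c f := by
    ext p
    simp [mul_sub]

/-- Both sides are `n(n+1)/2`: symmetric matrices of size `n` match skew matrices of size `n + 1`.
-/
theorem card_lt_pairs_le (n : ℕ) :
    Fintype.card {p : Fin (n + 1) × Fin (n + 1) // p.1 < p.2} ≤
      Fintype.card (Sym2 (Fin n)) := by
  have hcard := Sym2.card_subtype_not_diag (α := Fin (n + 1))
  rw [Fintype.card_fin] at hcard
  rw [Sym2.card, Fintype.card_fin, ← hcard]
  refine Fintype.card_le_of_injective
    (fun p => ⟨s(p.1.1, p.1.2), fun h => p.2.ne (Sym2.mk_isDiag_iff.1 h)⟩) ?_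
  rintro ⟨⟨i, j⟩, hij⟩ ⟨⟨k, l⟩, hkl⟩ h
  simp only [Subtype.mk.injEq, Sym2.eq_iff] at h
  rcases h with h | h
  · simp [h]
  · simp only at hij hkl
    rw [h.1, h.2] at hij
    exact absurd hij hkl.asymm

/-- The maps `S ↦ A S Bᵀ - B S Aᵀ` and `S ↦ A S Cᵀ - C S Aᵀ` go from symmetric to skew matrices,
spaces of equal dimension, so some combination of them is singular. -/
theorem exists_symmetric_intertwiner {n : ℕ} (hn : 0 < n)
    (A B C : Matrix (Fin (n + 1)) (Fin n) ℂ) :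
    ∃ (β γ : ℂ) (S : Matrix (Fin n) (Fin n) ℂ), (β ≠ 0 ∨ γ ≠ 0) ∧ S ≠ 0 ∧
      A * S * (β • B + γ • C).transpose = (β • B + γ • C) * S * A.transpose := by
  have : Nonempty (Sym2 (Fin n)) := ⟨s(⟨0, hn⟩, ⟨0, hn⟩)⟩
  obtain ⟨β, γ, f, hne, hf, h⟩ := exists_singular_combination (skewEntries A B)
    (skewEntries A C) (by simpa only [Module.finrank_fintype_fun_eq_card] using card_lt_pairs_le n)
  refine ⟨β, γ, symMatrix f, hne, ?_, ?_⟩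
  · intro h0
    refine hf (funext fun p => ?_)
    induction p with
    | _ i j => exact congrFun (congrFun h0 i) j
  · set D := β • B + γ • C with hD
    set K := A * symMatrix f * D.transpose - D * symMatrix f * A.transpose with hK
    have hskew : K.transpose = -K := by
      simp only [hK, Matrix.transpose_sub, Matrix.transpose_mul, Matrix.transpose_transpose,
        symMatrix_transpose, Matrix.mul_assoc, neg_sub]
    have hup : ∀ i j, i < j → K i j = 0 := by
      intro i j hij
      refine Eq.trans ?_ (congrFun h ⟨(i, j), hij⟩)
      simp only [hK, hD, skewEntries, Matrix.transpose_add, Matrix.transpose_smul,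
        Matrix.mul_add, Matrix.add_mul, Matrix.mul_smul, Matrix.smul_mul, Matrix.sub_apply,
        Matrix.add_apply, Matrix.smul_apply, LinearMap.coe_mk, AddHom.coe_mk, Pi.add_apply,
        Pi.smul_apply, smul_eq_mul]
      ring
    have hentry : ∀ i j, K j i = - K i j := fun i j => congrFun (congrFun hskew i) j
    rw [← sub_eq_zero]
    ext i j
    change K i j = 0
    rcases lt_trichotomy i j with hij | hij | hij
    · exact hup i j hij
    · subst hij
      exact self_eq_neg.1 (hentry i i)
    · rw [hentry j i, hup j i hij, neg_zero]

/-- Three matrices with one more row than columns have a nonzero combination that is not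
injective. -/
theorem Matrix.exists_singular_combination {n : ℕ} (hn : 0 < n)
    (A B C : Matrix (Fin (n + 1)) (Fin n) ℂ) :
    ∃ (α β γ : ℂ) (u : Fin n → ℂ), (α ≠ 0 ∨ β ≠ 0 ∨ γ ≠ 0) ∧ u ≠ 0 ∧
      α • A.mulVec u + β • B.mulVec u + γ • C.mulVec u = 0 := by
  obtain ⟨β, γ, S, hne, hS, hABC⟩ := exists_symmetric_intertwiner hn A B C
  set D := β • B + γ • C with hD
  have hDu : ∀ u, D.mulVec u = β • B.mulVec u + γ • C.mulVec u := fun u => by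
    rw [hD, Matrix.add_mulVec, Matrix.smul_mulVec, Matrix.smul_mulVec]
  by_cases hker : LinearMap.ker D.mulVecLin = ⊥
  swap
  · rw [Submodule.eq_bot_iff] at hker
    push Not at hker
    obtain ⟨u, hu, hu0⟩ := hker
    refine ⟨0, β, γ, u, Or.inr hne, hu0, ?_⟩
    rw [zero_smul, zero_add, ← hDu]
    exact hu
  obtain ⟨g, hg⟩ := LinearMap.exists_leftInverse_of_injective _ hker
  have hL : LinearMap.toMatrix' g * D = 1 := by
    have hD' : LinearMap.toMatrix' D.mulVecLin = D := LinearMap.toMatrix'_toLin' D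
    rw [← hD', ← LinearMap.toMatrix'_comp, hg, LinearMap.toMatrix'_id]
  set L := LinearMap.toMatrix' g
  -- A left inverse `L` of `D` turns the intertwining relation into the inclusion of `A (range S)`
  -- in `D (range S)`; on `range S` the pencil `(A, D)` is then no longer tall.
  have hAS : A * S = D * (S * (A.transpose * L.transpose)) := by
    calc A * S = A * S * (L * D).transpose := by rw [hL, Matrix.transpose_one, Matrix.mul_one]
      _ = A * S * D.transpose * L.transpose := by
        rw [Matrix.transpose_mul, Matrix.mul_assoc (A * S)]
      _ = _ := by rw [hABC]; simp only [Matrix.mul_assoc]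
  let I := LinearMap.range S.mulVecLin
  let J := I.map D.mulVecLin
  have hAI : ∀ x : I, A.mulVecLin x ∈ J := by
    rintro ⟨_, x, rfl⟩
    refine ⟨S.mulVec ((A.transpose * L.transpose).mulVec x), ⟨_, rfl⟩, ?_⟩
    simp only [Matrix.mulVecLin_apply, Matrix.mulVec_mulVec, hAS]
  have hDI : ∀ x : I, D.mulVecLin x ∈ J := fun x => ⟨x, x.2, rfl⟩
  have hInt : Nontrivial I := by
    rw [Submodule.nontrivial_iff_ne_bot]
    intro h
    rw [LinearMap.range_eq_bot] at h
    exact hS (Matrix.toLin'.injective (by rw [map_zero]; exact h))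
  obtain ⟨α, δ, u, hαδ, hu, h⟩ := _root_.exists_singular_combination
    ((A.mulVecLin ∘ₗ I.subtype).codRestrict J hAI) ((D.mulVecLin ∘ₗ I.subtype).codRestrict J hDI)
    (Submodule.finrank_map_le _ _)
  have h' : α • A.mulVec u + δ • D.mulVec u = 0 := congrArg Subtype.val h
  refine ⟨α, δ * β, δ * γ, u, ?_, fun h0 => hu (Subtype.ext h0), ?_⟩
  · by_cases hδ : δ = 0
    · exact Or.inl (hαδ.resolve_right (not_not.2 hδ))
    · exact Or.inr (hne.imp (mul_ne_zero hδ) (mul_ne_zero hδ))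
  · rw [← h', hDu]
    module

theorem exists_singular_combination_of_finrank_eq_add_one {V W : Type*} [AddCommGroup V]
    [Module ℂ V] [AddCommGroup W] [Module ℂ W] [FiniteDimensional ℂ V] [FiniteDimensional ℂ W]
    {n : ℕ} (hn : 0 < n) (hV : Module.finrank ℂ V = n) (hW : Module.finrank ℂ W = n + 1)
    (A B C : V →ₗ[ℂ] W) :
    ∃ (α β γ : ℂ) (u : V), (α ≠ 0 ∨ β ≠ 0 ∨ γ ≠ 0) ∧ u ≠ 0 ∧
      α • A u + β • B u + γ • C u = 0 := by
  let bV := Module.finBasisOfFinrankEq ℂ V hV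
  let bW := Module.finBasisOfFinrankEq ℂ W hW
  obtain ⟨α, β, γ, u, hne, hu, h⟩ := Matrix.exists_singular_combination hn
    (LinearMap.toMatrix bV bW A) (LinearMap.toMatrix bV bW B) (LinearMap.toMatrix bV bW C)
  refine ⟨α, β, γ, bV.equivFun.symm u, hne, (LinearEquiv.map_ne_zero_iff _).2 hu, ?_⟩
  apply bW.equivFun.injective
  have key : ∀ F : V →ₗ[ℂ] W, bW.equivFun (F (bV.equivFun.symm u)) =
      (LinearMap.toMatrix bV bW F).mulVec u := by
    intro F
    have := LinearMap.toMatrix_mulVec_repr bV bW F (bV.equivFun.symm u)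
    rw [← Module.Basis.equivFun_apply, LinearEquiv.apply_symm_apply] at this
    exact this.symm
  simp only [map_add, map_smul, key, map_zero]
  exact h

/-! ### Normalization and induction on the size -/

theorem exists_normalized_of_singular_combination {X Y Z : Type*} [AddCommGroup X] [Module ℂ X]
    [AddCommGroup Y] [Module ℂ Y] [AddCommGroup Z] [Module ℂ Z]
    (A B C : X →ₗ[ℂ] Y →ₗ[ℂ] ℂ) (z₀ z₁ z₂ : Z) {α β γ : ℂ} {u : X}
    (hne : α ≠ 0 ∨ β ≠ 0 ∨ γ ≠ 0) (h : α • A u + β • B u + γ • C u = 0) :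
    ∃ (A' B' C' : X →ₗ[ℂ] Y →ₗ[ℂ] ℂ) (w₀ w₁ w₂ : Z), A' u = 0 ∧ ∀ x y,
      A x y • z₀ + B x y • z₁ + C x y • z₂ = A' x y • w₀ + B' x y • w₁ + C' x y • w₂ := by
  rcases hne with hα | hβ | hγ
  · refine ⟨α • A + β • B + γ • C, B, C, α⁻¹ • z₀, z₁ - (α⁻¹ * β) • z₀, z₂ - (α⁻¹ * γ) • z₀,
      h, fun x y => ?_⟩
    simp only [LinearMap.add_apply, LinearMap.smul_apply, smul_eq_mul]
    match_scalars <;> field_simp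
    ring
  · refine ⟨α • A + β • B + γ • C, A, C, β⁻¹ • z₁, z₀ - (β⁻¹ * α) • z₁, z₂ - (β⁻¹ * γ) • z₁,
      h, fun x y => ?_⟩
    simp only [LinearMap.add_apply, LinearMap.smul_apply, smul_eq_mul]
    match_scalars <;> field_simp
    ring
  · refine ⟨α • A + β • B + γ • C, A, B, γ⁻¹ • z₂, z₀ - (γ⁻¹ * α) • z₂, z₁ - (γ⁻¹ * β) • z₂,
      h, fun x y => ?_⟩
    simp only [LinearMap.add_apply, LinearMap.smul_apply, smul_eq_mul]
    match_scalars <;> field_simp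
    ring

/-- The functionals `A x` span fewer than `dim Y` dimensions, hence have a common zero. -/
theorem exists_right_kernel {X Y : Type*} [AddCommGroup X] [Module ℂ X] [AddCommGroup Y]
    [Module ℂ Y] [FiniteDimensional ℂ X] [FiniteDimensional ℂ Y] (A : X →ₗ[ℂ] Y →ₗ[ℂ] ℂ) {u : X}
    (hu : u ≠ 0) (hAu : A u = 0) (hXY : Module.finrank ℂ X ≤ Module.finrank ℂ Y) :
    ∃ v, v ≠ 0 ∧ ∀ x, A x v = 0 := by
  have h1 := LinearMap.finrank_range_add_finrank_ker A
  have h2 : 0 < Module.finrank ℂ (LinearMap.ker A) := by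
    have : Nontrivial (LinearMap.ker A) :=
      ⟨⟨u, hAu⟩, 0, fun h => hu (congrArg Subtype.val h)⟩
    exact Module.finrank_pos
  let ev : Y →ₗ[ℂ] Module.Dual ℂ (LinearMap.range A) := (LinearMap.range A).subtype.flip
  have h3 : LinearMap.ker ev ≠ ⊥ := by
    refine LinearMap.ker_ne_bot_of_finrank_lt ?_
    rw [Subspace.dual_finrank_eq]
    omega
  obtain ⟨v, hv, hv0⟩ := Submodule.exists_mem_ne_zero_of_ne_bot h3
  exact ⟨v, hv0, fun x => LinearMap.congr_fun hv ⟨A x, x, rfl⟩⟩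

/-- Every `m × n × 3` tensor has rank at most `r`, without reference to bases. -/
def TripleRankBound (Z : Type*) [AddCommGroup Z] [Module ℂ Z] (m n r : ℕ) : Prop :=
  ∀ (X Y : Type) [AddCommGroup X] [Module ℂ X] [AddCommGroup Y] [Module ℂ Y]
    [FiniteDimensional ℂ X] [FiniteDimensional ℂ Y], Module.finrank ℂ X = m →
    Module.finrank ℂ Y = n → ∀ (A B C : X →ₗ[ℂ] Y →ₗ[ℂ] ℂ) (z₀ z₁ z₂ : Z),
    BilinRankLE (fun x y => A x y • z₀ + B x y • z₁ + C x y • z₂) r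

namespace TripleRankBound

variable {Z : Type*} [AddCommGroup Z] [Module ℂ Z]

theorem flip {m n r : ℕ} (h : TripleRankBound Z m n r) : TripleRankBound Z n m r := by
  intro X Y _ _ _ _ _ _ hX hY A B C z₀ z₁ z₂
  exact (h Y X hY hX A.flip B.flip C.flip z₀ z₁ z₂).flip

/-- Split `Y` as `ker ψ ⊕ ℂ v`, and pay for the two parts separately. -/
theorem of_column {m n r s : ℕ} (hmn : TripleRankBound Z m n r) {X Y : Type} [AddCommGroup X]
    [Module ℂ X] [AddCommGroup Y] [Module ℂ Y] [FiniteDimensional ℂ X] [FiniteDimensional ℂ Y]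
    (hX : Module.finrank ℂ X = m) (hY : Module.finrank ℂ Y = n + 1)
    (A B C : X →ₗ[ℂ] Y →ₗ[ℂ] ℂ) (z₀ z₁ z₂ : Z) {v : Y} (hv : v ≠ 0)
    (hcol : ∀ ψ : Module.Dual ℂ Y,
      BilinRankLE (fun x y => ψ y • (A x v • z₀ + B x v • z₁ + C x v • z₂)) s) :
    BilinRankLE (fun x y => A x y • z₀ + B x y • z₁ + C x y • z₂) (r + s) := by
  obtain ⟨ψ, hψ⟩ : ∃ ψ : Module.Dual ℂ Y, ψ v = 1 := by
    obtain ⟨ψ, hψ⟩ : ∃ ψ : Module.Dual ℂ Y, ψ v ≠ 0 := by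
      by_contra! H
      exact hv ((Module.forall_dual_apply_eq_zero_iff ℂ v).1 H)
    exact ⟨(ψ v)⁻¹ • ψ, by simp [hψ]⟩
  let Y' := LinearMap.ker ψ
  let π : Y →ₗ[ℂ] Y' := (LinearMap.id - ψ.smulRight v).codRestrict Y' fun y => by
    simp [Y', LinearMap.mem_ker, hψ]
  have hπ : ∀ y, (π y : Y) = y - ψ y • v := fun y => rfl
  have hY' : Module.finrank ℂ Y' = n := by
    have h1 := LinearMap.finrank_range_add_finrank_ker ψ
    have h2 : LinearMap.range ψ = ⊤ := by
      rw [LinearMap.range_eq_top]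
      exact fun c => ⟨c • v, by simp [hψ]⟩
    rw [h2, finrank_top, Module.finrank_self, hY] at h1
    change Module.finrank ℂ (LinearMap.ker ψ) = n
    omega
  have h1 := hmn X Y' hX hY' (A.compl₂ Y'.subtype) (B.compl₂ Y'.subtype) (C.compl₂ Y'.subtype)
    z₀ z₁ z₂
  refine ((h1.comp LinearMap.id π).add (hcol ψ)).congr fun x y => ?_
  simp only [LinearMap.compl₂_apply, LinearMap.id_apply, Submodule.subtype_apply, hπ, map_sub,
    map_smul, smul_eq_mul]
  module

theorem of_row_eq_zero {m n r : ℕ} (hmn : TripleRankBound Z m n r) {X Y : Type} [AddCommGroup X]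
    [Module ℂ X] [AddCommGroup Y] [Module ℂ Y] [FiniteDimensional ℂ X] [FiniteDimensional ℂ Y]
    (hX : Module.finrank ℂ X = m + 1) (hY : Module.finrank ℂ Y = n)
    (A B C : X →ₗ[ℂ] Y →ₗ[ℂ] ℂ) (z₀ z₁ z₂ : Z) {u : X} (hu : u ≠ 0) (hA : A u = 0)
    (hB : B u = 0) (hC : C u = 0) :
    BilinRankLE (fun x y => A x y • z₀ + B x y • z₁ + C x y • z₂) r :=
  (hmn.flip.of_column (s := 0) hY hX A.flip B.flip C.flip z₀ z₁ z₂ hu fun ψ =>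
    (BilinRankLE.zero 0).congr fun x y => by simp [hA, hB, hC]).flip

theorem of_right_kernel {m n r : ℕ} (hmn : TripleRankBound Z m n r) {X Y : Type}
    [AddCommGroup X] [Module ℂ X] [AddCommGroup Y] [Module ℂ Y] [FiniteDimensional ℂ X]
    [FiniteDimensional ℂ Y] (hX : Module.finrank ℂ X = m) (hY : Module.finrank ℂ Y = n + 1)
    (A B C : X →ₗ[ℂ] Y →ₗ[ℂ] ℂ) (z₀ z₁ z₂ : Z) {v : Y} (hv : v ≠ 0) {f : Module.Dual ℂ X} {z : Z}
    (hA : ∀ x, A x v = 0) (hf : ∀ x, B x v • z₁ + C x v • z₂ = f x • z) :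
    BilinRankLE (fun x y => A x y • z₀ + B x y • z₁ + C x y • z₂) (r + 1) :=
  hmn.of_column hX hY A B C z₀ z₁ z₂ hv fun ψ =>
    (BilinRankLE.pure f ψ z).congr fun x y => by
      rw [hA, zero_smul, zero_add, hf, smul_comm]

/-- For dimension reasons `A` kills some column `v`, where only `B` and `C` remain to be paid for.
-/
theorem add_two {n r : ℕ} (hmn : TripleRankBound Z n (n + 1) r) :
    TripleRankBound Z n (n + 2) (r + 2) := by
  intro X Y _ _ _ _ _ _ hX hY A B C z₀ z₁ z₂
  have hker : LinearMap.ker A.flip ≠ ⊥ := by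
    refine LinearMap.ker_ne_bot_of_finrank_lt ?_
    rw [Subspace.dual_finrank_eq]
    omega
  obtain ⟨v, hAv, hv⟩ := Submodule.exists_mem_ne_zero_of_ne_bot hker
  refine hmn.of_column hX hY A B C z₀ z₁ z₂ hv fun ψ =>
    ((BilinRankLE.pure (B.flip v) ψ z₁).add (BilinRankLE.pure (C.flip v) ψ z₂)).congr
      fun x y => ?_
  have hx : A x v = 0 := LinearMap.congr_fun hAv x
  simp only [hx, LinearMap.flip_apply]
  module

theorem square_succ {n : ℕ} (h : TripleRankBound Z n (n + 1) (2 * n)) :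
    TripleRankBound Z (n + 1) (n + 1) (2 * n + 1) := by
  intro X Y _ _ _ _ _ _ hX hY A B C z₀ z₁ z₂
  have : Nontrivial X := Module.nontrivial_of_finrank_pos (R := ℂ) (by omega)
  obtain ⟨α, β, u, hne, hu, hαβ⟩ := exists_singular_combination (W := Module.Dual ℂ Y) A B
    (by rw [Subspace.dual_finrank_eq, hX, hY])
  obtain ⟨A', B', C', w₀, w₁, w₂, hA'u, hT⟩ := exists_normalized_of_singular_combination A B C
    z₀ z₁ z₂ (γ := 0) (hne.imp id Or.inl) (by rw [zero_smul, add_zero]; exact hαβ)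
  obtain ⟨v, hv, hA'v⟩ := exists_right_kernel A' hu hA'u (by omega)
  suffices H : BilinRankLE (fun x y => A' x y • w₀ + B' x y • w₁ + C' x y • w₂) (2 * n + 1) from
    H.congr hT
  rcases bilinRankLE_or_of_kernels A' B' C' w₀ w₁ w₂ hA'u hA'v (r := 2 * n + 1) (by omega) with
    H | ⟨f, z, hf⟩ | ⟨hB, hC⟩
  · exact H
  · exact h.flip.of_right_kernel hX hY A' B' C' w₀ w₁ w₂ hv hA'v hf
  · exact (h.of_row_eq_zero hX hY A' B' C' w₀ w₁ w₂ hu hA'u hB hC).mono (by omega)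

/-- A degenerate column leaves a square problem plus one product; a zero row leaves size `n × (n +
2)`, which `add_two` bounds by `2n + 2`. -/
theorem rectangular_succ {n : ℕ} (h : TripleRankBound Z n (n + 1) (2 * n)) :
    TripleRankBound Z (n + 1) (n + 2) (2 * (n + 1)) := by
  intro X Y _ _ _ _ _ _ hX hY A B C z₀ z₁ z₂
  obtain ⟨α, β, γ, u, hne, hu, hαβ⟩ := exists_singular_combination_of_finrank_eq_add_one
    (W := Module.Dual ℂ Y) n.succ_pos hX (by rw [Subspace.dual_finrank_eq, hY]) A B C
  obtain ⟨A', B', C', w₀, w₁, w₂, hA'u, hT⟩ := exists_normalized_of_singular_combination A B C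
    z₀ z₁ z₂ hne hαβ
  obtain ⟨v, hv, hA'v⟩ := exists_right_kernel A' hu hA'u (by omega)
  suffices H : BilinRankLE (fun x y => A' x y • w₀ + B' x y • w₁ + C' x y • w₂)
    (2 * (n + 1)) from H.congr hT
  rcases bilinRankLE_or_of_kernels A' B' C' w₀ w₁ w₂ hA'u hA'v (r := 2 * (n + 1)) (by omega) with
    H | ⟨f, z, hf⟩ | ⟨hB, hC⟩
  · exact H
  · exact h.square_succ.of_right_kernel hX hY A' B' C' w₀ w₁ w₂ hv hA'v hf
  · exact h.add_two.of_row_eq_zero hX hY A' B' C' w₀ w₁ w₂ hu hA'u hB hC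

theorem rectangular (n : ℕ) : TripleRankBound Z n (n + 1) (2 * n) := by
  induction n with
  | zero =>
    intro X Y _ _ _ _ _ _ hX hY A B C z₀ z₁ z₂
    have : Subsingleton X := Module.finrank_zero_iff.1 hX
    exact (BilinRankLE.zero 0).congr fun x y => by simp [Subsingleton.elim x 0]
  | succ n ih => exact ih.rectangular_succ

theorem square {n : ℕ} (hn : 1 ≤ n) : TripleRankBound Z n n (2 * n - 1) := by
  obtain ⟨k, rfl⟩ := Nat.exists_eq_add_of_le' hn
  exact (rectangular k).square_succ

end TripleRankBound

/-! ### Return to tensors -/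

theorem TripleRankBound.isSumOfPure {m n r : ℕ} (h : TripleRankBound (Fin 3 → ℂ) m n r)
    (x : Tensor3 ℂ m n 3) : IsSumOfPure x r := by
  let E := ((Pi.basisFun ℂ (Fin m)).tensorProduct (Pi.basisFun ℂ (Fin n))).tensorProduct
    (Pi.basisFun ℂ (Fin 3))
  let S : Fin 3 → (Fin m → ℂ) →ₗ[ℂ] (Fin n → ℂ) →ₗ[ℂ] ℂ := fun k =>
    Matrix.toLinearMap₂' ℂ (Matrix.of fun i j => E.repr x ((i, j), k))
  obtain ⟨f, g, z, hfg⟩ := h (Fin m → ℂ) (Fin n → ℂ) (by simp) (by simp) (S 0) (S 1) (S 2)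
    (Pi.single 0 1) (Pi.single 1 1) (Pi.single 2 1)
  refine ⟨fun l i => f l (Pi.single i 1), fun l j => g l (Pi.single j 1), z, ?_⟩
  refine E.ext_elem fun ⟨⟨i, j⟩, k⟩ => ?_
  have hS : ∀ k, S k (Pi.single i 1) (Pi.single j 1) = E.repr x ((i, j), k) := fun k => by
    simp [S, Matrix.toLinearMap₂'_apply, Pi.single_apply]
  have hk := congrFun (hfg (Pi.single i 1) (Pi.single j 1)) k
  simp only [hS] at hk
  have hl : E.repr x ((i, j), k) = ∑ l, f l (Pi.single i 1) * (g l (Pi.single j 1) * z l k) := by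
    rw [Finset.sum_apply] at hk
    simp only [Pi.smul_apply, smul_eq_mul] at hk
    rw [← hk]
    fin_cases k <;> simp
  rw [hl, map_sum, Finsupp.finsetSum_apply]
  refine Finset.sum_congr rfl fun l _ => ?_
  simp only [E, Module.Basis.tensorProduct_repr_tmul_apply, Pi.basisFun_repr, smul_eq_mul]
  ring

theorem TripleRankBound.maxRank_le {m n r : ℕ} (h : TripleRankBound (Fin 3 → ℂ) m n r) :
    maxRank ℂ m n 3 ≤ r := by
  obtain ⟨x, hx⟩ := (isGreatest_maxRank ℂ m n 3).1
  rw [← hx]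
  exact (isLeast_tensorRank x).2 (h.isSumOfPure x)

theorem mainTheorem3 (n : ℕ) (hn : 1 ≤ n) :
    maxRank ℂ n n 3 ≤ 2 * n - 1 ∧ maxRank ℂ n (n + 1) 3 ≤ 2 * n :=
  ⟨(TripleRankBound.square hn).maxRank_le, (TripleRankBound.rectangular n).maxRank_le⟩
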